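/- Let $\mathbb O$ be either the unit disk $\mathbb D=\{|z|<1\}$ or the upper half plane $\mathbb U=\{\mathrm{Im}\,z>0\}$, with boundary $\partial\mathbb O=\mathbb T$ (the unit circle), respectively $\partial\mathbb O=\mathbb R\cup\{\infty\}$, in the Riemann sphere. Put $\alpha_0=0$ and $\varpi_\alpha(z)=1-\overline\alpha z$ in the disk case, $\alpha_0=i$ and $\varpi_\alpha(z)=z-\overline\alpha$ in the half plane case. For $\alpha\in\mathbb O$ let $$\zeta_\alpha(z)=z_\alpha\frac{z-\alpha}{\varpi_\alpha(z)},\qquad z_{\alpha_0}=1,\qquad z_\alpha=-\frac{|\alpha|}{\alpha}\ \text{ (disk)},\quad z_\alpha=\frac{|1+\alpha^2|}{1+\alpha^2}\ \text{ (half plane)}\quad\text{for }\alpha\neq\alpha_0 .$$ Write $\zeta_0=\zeta_{\alpha_0}$, and for $t\in\partial\mathbb O$, $z\in\mathbb O$ let $$D(t,z)=\frac{\zeta_0(t)+\zeta_0(z)}{\zeta_0(t)-\zeta_0(z)},\qquad D_R=\mathrm{Re}\,D,\quad D_I=\mathrm{Im}\,D .$$ For a Borel probability measure $\mu$ on $\partial\mathbb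 O$ define its $\alpha$-Carathéodory function $$F_\alpha(z;d\mu)=\int\frac{D(t,z)}{D_R(t,\alpha)}\,d\mu(t)-i\int\frac{D_I(t,\alpha)}{D_R(t,\alpha)}\,d\mu(t),\qquad z\in\mathbb O,$$ which satisfies $F_\alpha(\alpha;d\mu)=1$, and its $\alpha$-Schur function $$f_\alpha(z;d\mu)=\frac1{\zeta_\alpha(z)}\,\frac{F_\alpha(z;d\mu)-1}{F_\alpha(z;d\mu)+1},$$ extended by its limit to the removable singularity $z=\alpha$. **Theorem.** Let $(\alpha_k)$, $(\beta_k)$ be two sequences, each contained in some compact subset of $\mathbb O$, with $\alpha_k-\beta_k\to0$, and let $(d\mu^k)$, $(d\nu^k)$ be two sequences of Borel probability measures on $\partial\mathbb O$. Consider the conditions 1. $F_{\alpha_k}(\cdot;d\mu^k)-F_{\beta_k}(\cdot;d\nu^k)\to0$ uniformly on compact subsets of $\mathbb O$; 2. $f_{\alpha_k}(\cdot;d\mu^k)-f_{\beta_k}(\cdot;d\nu^k)\to0$ uniformly on compact subsets of $\mathbb O$; 3. $d\mu^k-d\nu^k\to0$ in the weak-* sense, i.e. $\int\varphi\,d\mu^k-\int\varphi\,d\nu^k\to0$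 for every continuous $\varphi:\partial\mathbb O\to\mathbb C$. Then (1) and (3) are equivalent. If moreover $z_{\alpha_k}-z_{\beta_k}\to0$ (which is automatic if $\alpha_0$ is not a limit point of $(\alpha_k)$, or if $\alpha_k=\beta_k$ for all $k$), then (1), (2) and (3) are all equivalent. -/

import Mathlib

open Complex MeasureTheory Filter Topology

noncomputable section

namespace SchurCara

/-- The two settings that are treated simultaneously: the unit disk `|z| < 1`, and the
upper half plane `Im z > 0`. -/
inductive Setting : Type
  | disk
  | halfPlane

namespace Setting

/-- The open domain `𝕆`. -/
def domain : Setting → Set ℂ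
  | disk => {z | ‖z‖ < 1}
  | halfPlane => {z | 0 < z.im}

/-- The boundary `∂𝕆` in the Riemann sphere: the unit circle, respectively the extended real line
`ℝ ∪ {∞}` (the one point compactification of `ℝ`). -/
def Boundary : Setting → Type
  | disk => Circle
  | halfPlane => OnePoint ℝ

instance (O : Setting) : TopologicalSpace O.Boundary :=
  match O with
  | disk => inferInstanceAs (TopologicalSpace Circle)
  | halfPlane => inferInstanceAs (TopologicalSpace (OnePoint ℝ))

instance (O : Setting) : MeasurableSpace O.Boundary := borel O.Boundary

instance (O : Setting) : BorelSpace O.Boundary := ⟨rfl⟩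

/-- The base point `α₀`: `0` for the disk, `i` for the half plane. -/
def base : Setting → ℂ
  | disk => 0
  | halfPlane => I

/-- `ϖ_α(z)`. -/
def varpi : Setting → ℂ → ℂ → ℂ
  | disk, α, z => 1 - (starRingEnd ℂ) α * z
  | halfPlane, α, z => z - (starRingEnd ℂ) α

open Classical in
/-- The unimodular constant `z_α`, with the convention `z_α = 1` for `α = α₀`. -/
def zconst (O : Setting) (α : ℂ) : ℂ :=
  if α = O.base then 1
  else match O with
    | disk => -((‖α‖ : ℝ) : ℂ) / α
    | halfPlane => ((‖1 + α ^ 2‖ : ℝ) : ℂ) / (1 + α ^ 2)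

/-- `ζ_α(z) = z_α (z - α) / ϖ_α(z)`. -/
def zeta (O : Setting) (α z : ℂ) : ℂ := O.zconst α * ((z - α) / O.varpi α z)

/-- The values of `ζ₀ = ζ_{α₀}` on the boundary, with `ζ₀(∞) = 1` for the half plane. -/
def zetaBdry : (O : Setting) → O.Boundary → ℂ
  | disk => fun t : Circle => zeta disk (base disk) (t : ℂ)
  | halfPlane => fun t : OnePoint ℝ =>
      t.elim 1 (fun x : ℝ => zeta halfPlane (base halfPlane) (x : ℂ))

/-- The kernel `D(t,z) = (ζ₀(t) + ζ₀(z)) / (ζ₀(t) - ζ₀(z))` for `t ∈ ∂𝕆`. -/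
def D (O : Setting) (t : O.Boundary) (z : ℂ) : ℂ :=
  (O.zetaBdry t + O.zeta O.base z) / (O.zetaBdry t - O.zeta O.base z)

/-- `D_R(t,z) = (D(t,z) + D_*(t,z)) / 2`. On the boundary `D_*(t,z)` is the complex conjugate
of `D(t,z)`, so that this is the real part. -/
def DR (O : Setting) (t : O.Boundary) (z : ℂ) : ℝ := (O.D t z).re

/-- `D_I(t,z) = (D(t,z) - D_*(t,z)) / (2i)`, the imaginary part of `D(t,z)` for `t ∈ ∂𝕆`. -/
def DI (O : Setting) (t : O.Boundary) (z : ℂ) : ℝ := (O.D t z).im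

/-- The C-function `F(z;dμ) = ∫ D(t,z) dμ(t)`. -/
def F (O : Setting) (μ : Measure O.Boundary) (z : ℂ) : ℂ := ∫ t, O.D t z ∂μ

/-- The constant `c_α(dμ) = -∫ D_I(t,α) / D_R(t,α) dμ(t)`. -/
def c (O : Setting) (α : ℂ) (μ : Measure O.Boundary) : ℝ := -∫ t, O.DI t α / O.DR t α ∂μ

/-- The `α`-C-function `F_α(z;dμ) = F(z; dμ / D_R(·,α)) + i c_α(dμ)`. -/
def Fα (O : Setting) (α : ℂ) (μ : Measure O.Boundary) (z : ℂ) : ℂ :=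
  O.F (μ.withDensity fun t => ENNReal.ofReal (1 / O.DR t α)) z + I * O.c α μ

/-- The `α`-S-function `f_α(z;dμ)`: the function `ζ_α⁻¹ (F_α - 1) / (F_α + 1)`, extended to
its removable singularity `z = α` by its limit there. -/
def fα (O : Setting) (α : ℂ) (μ : Measure O.Boundary) : ℂ → ℂ :=
  let g : ℂ → ℂ := fun z => 1 / O.zeta α z * ((O.Fα α μ z - 1) / (O.Fα α μ z + 1))
  Function.update g α (limUnder (𝓝[≠] α) g)

/-- The sequence `(α_k)` is compactly included in `𝕆`. -/
def CompactlyIncluded (O : Setting) (α : ℕ → ℂ) : Prop :=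
  ∃ K : Set ℂ, IsCompact K ∧ K ⊆ O.domain ∧ ∀ k, α k ∈ K

/-- `h^k ⇉ 0`: uniform convergence to zero on the compact subsets of `𝕆`. -/
def TendsToZeroOnCompacts (O : Setting) (h : ℕ → ℂ → ℂ) : Prop :=
  ∀ K : Set ℂ, IsCompact K → K ⊆ O.domain → TendstoUniformlyOn h (fun _ => 0) atTop K

/-- `dμ^k - dν^k → 0` in the weak-* sense, tested on the continuous functions on `∂𝕆`. -/
def DiffWeakStarToZero (O : Setting) (μ ν : ℕ → Measure O.Boundary) : Prop :=
  ∀ φ : C(O.Boundary, ℂ), Tendsto (fun k => ∫ t, φ t ∂(μ k) - ∫ t, φ t ∂(ν k)) atTop (𝓝 0)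

end Setting

end SchurCara

end

/-! The map `ζ₀` carries everything to the unit disk: the boundary becomes a compact space `X` with
an injective unimodular coordinate `τ`, and with `a = ζ₀(α)`, `w = ζ₀(z)` the function `F_α(z)` is
the integral of `caraKernel τ (a, w)` (`Fα_eq`). This kernel depends continuously on `(a, w)` in sup
norm. Uniform convergence on compacts is tested along sequences `z_k` in a compact set, so every
claim concerns bounded sequences whose difference tends to zero.

(3) ⇒ (1): differences of probability measures are functionals of norm at most 2, so pointwise
convergence to zero is uniform on compact sets of test functions.

(1) ⇒ (3), `tendsto_integral_sub_of_cara`: weight each measure by its reciprocal Poisson kernel. `Re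
F_α` at `w = 0` is the mass of the weighted measure, and `F_α(w) - F_α(0)` is `2w` times its Cauchy
transform. The closed self-adjoint space of test functions on which the weighted difference vanishes
in the limit thus contains `1` and the Cauchy kernels, hence everything by Stone–Weierstrass. The
weight is removed by testing against Poisson kernels, which stay in a compact set.

(2) is tied to the rest by `ζ_α f_α = (F_α - 1)/(F_α + 1)`, with `|F_α + 1| ≥ 1` since `Re F_α ≥ 0`.
Division by `ζ_α` near its moving zero is avoided: `fα_eq` cancels that zero explicitly against a
factor of `F_α - 1`. -/

namespace SchurCara

/-! ### Sequences contained in compact sets, and pairs of asymptotically equal sequences -/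

section Sequences

variable {E G : Type*} [NormedAddCommGroup E] [NormedAddCommGroup G]

/-- The sequence `x` stays in a compact subset of `U`. -/
def PrecompactIn (U : Set E) (x : ℕ → E) : Prop :=
  ∃ K : Set E, IsCompact K ∧ K ⊆ U ∧ ∀ k, x k ∈ K

/-- Both sequences are bounded and their difference tends to zero. -/
structure BddClose (x y : ℕ → E) : Prop where
  left : ∃ C, ∀ k, ‖x k‖ ≤ C
  right : ∃ C, ∀ k, ‖y k‖ ≤ C
  tendsto : Tendsto (fun k => x k - y k) atTop (𝓝 0)

theorem PrecompactIn.mem {U : Set E} {x : ℕ → E} (h : PrecompactIn U x) (k : ℕ) : x k ∈ U := by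
  obtain ⟨K, -, hU, hx⟩ := h
  exact hU (hx k)

theorem PrecompactIn.image {U : Set E} {V : Set G} {x : ℕ → E} (h : PrecompactIn U x)
    {g : E → G} (hg : ContinuousOn g U) (hUV : Set.MapsTo g U V) :
    PrecompactIn V (fun k => g (x k)) := by
  obtain ⟨K, hK, hU, hx⟩ := h
  exact ⟨g '' K, hK.image_of_continuousOn (hg.mono hU), (hUV.mono_left hU).image_subset,
    fun k => ⟨x k, hx k, rfl⟩⟩

theorem PrecompactIn.prodMk {U : Set E} {V : Set G} {x : ℕ → E} {y : ℕ → G}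
    (hx : PrecompactIn U x) (hy : PrecompactIn V y) :
    PrecompactIn (U ×ˢ V) (fun k => (x k, y k)) := by
  obtain ⟨K, hK, hU, hx⟩ := hx
  obtain ⟨K', hK', hV, hy⟩ := hy
  exact ⟨K ×ˢ K', hK.prod hK', Set.prod_mono hU hV, fun k => ⟨hx k, hy k⟩⟩

theorem PrecompactIn.bdd {U : Set E} {x : ℕ → E} (h : PrecompactIn U x) :
    ∃ C, ∀ k, ‖x k‖ ≤ C := by
  obtain ⟨K, hK, -, hx⟩ := h
  obtain ⟨C, hC⟩ := hK.isBounded.exists_norm_le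
  exact ⟨C, fun k => hC _ (hx k)⟩

theorem PrecompactIn.bdd_comp {U : Set E} {x : ℕ → E} (h : PrecompactIn U x)
    {g : E → G} (hg : ContinuousOn g U) : ∃ C, ∀ k, ‖g (x k)‖ ≤ C :=
  (h.image hg (Set.mapsTo_univ g U)).bdd

/-- Heine–Cantor on the union of the two compact sets; neither sequence has to converge. -/
theorem PrecompactIn.bddClose {U : Set E} {x y : ℕ → E} (hx : PrecompactIn U x)
    (hy : PrecompactIn U y) (hxy : Tendsto (fun k => x k - y k) atTop (𝓝 0))
    {g : E → G} (hg : ContinuousOn g U) :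
    BddClose (fun k => g (x k)) (fun k => g (y k)) := by
  refine ⟨hx.bdd_comp hg, hy.bdd_comp hg, ?_⟩
  obtain ⟨K, hK, hKU, hx⟩ := hx
  obtain ⟨K', hK', hKU', hy⟩ := hy
  have hu := (hK.union hK').uniformContinuousOn_of_continuous
    (hg.mono (Set.union_subset hKU hKU'))
  rw [Metric.uniformContinuousOn_iff] at hu
  rw [Metric.tendsto_atTop] at hxy ⊢
  intro ε hε
  obtain ⟨δ, hδ, h⟩ := hu ε hε
  obtain ⟨N, hN⟩ := hxy δ hδ
  refine ⟨N, fun n hn => ?_⟩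
  have := h (x n) (Or.inl (hx n)) (y n) (Or.inr (hy n)) (by simpa [dist_eq_norm] using hN n hn)
  simpa [dist_eq_norm] using this

theorem exists_norm_mul_le {x y : ℕ → ℂ} (hx : ∃ C, ∀ k, ‖x k‖ ≤ C)
    (hy : ∃ C, ∀ k, ‖y k‖ ≤ C) : ∃ C, ∀ k, ‖x k * y k‖ ≤ C := by
  obtain ⟨C, hC⟩ := hx
  obtain ⟨C', hC'⟩ := hy
  refine ⟨C * C', fun k => ?_⟩
  rw [norm_mul]
  exact mul_le_mul (hC k) (hC' k) (norm_nonneg _) ((norm_nonneg _).trans (hC k))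

theorem tendsto_zero_mul_bdd {x y : ℕ → ℂ} (hx : Tendsto x atTop (𝓝 0))
    (hy : ∃ C, ∀ k, ‖y k‖ ≤ C) : Tendsto (fun k => x k * y k) atTop (𝓝 0) := by
  obtain ⟨C, hC⟩ := hy
  refine squeeze_zero_norm (a := fun k => ‖x k‖ * C) (fun k => ?_) ?_
  · rw [norm_mul]
    exact mul_le_mul_of_nonneg_left (hC k) (norm_nonneg _)
  · simpa using hx.norm.mul_const C

theorem BddClose.mul {x y x' y' : ℕ → ℂ} (h : BddClose x y) (h' : BddClose x' y') :
    BddClose (fun k => x k * x' k) (fun k => y k * y' k) := by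
  refine ⟨exists_norm_mul_le h.left h'.left, exists_norm_mul_le h.right h'.right, ?_⟩
  have := (tendsto_zero_mul_bdd h.tendsto h'.left).add (tendsto_zero_mul_bdd h'.tendsto h.right)
  rw [add_zero] at this
  exact this.congr fun k => by ring

theorem BddClose.inv {x y : ℕ → ℂ} (h : Tendsto (fun k => x k - y k) atTop (𝓝 0))
    (hx : ∀ k, 1 ≤ ‖x k‖) (hy : ∀ k, 1 ≤ ‖y k‖) :
    BddClose (fun k => (x k)⁻¹) (fun k => (y k)⁻¹) := by
  have key : ∀ z : ℕ → ℂ, (∀ k, 1 ≤ ‖z k‖) → ∃ C, ∀ k, ‖(z k)⁻¹‖ ≤ C := fun z hz =>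
    ⟨1, fun k => by rw [norm_inv]; exact inv_le_one_of_one_le₀ (hz k)⟩
  refine ⟨key x hx, key y hy, ?_⟩
  have := (tendsto_zero_mul_bdd h (exists_norm_mul_le (key x hx) (key y hy))).neg
  rw [neg_zero] at this
  refine this.congr fun k => ?_
  have h1 : x k ≠ 0 := norm_pos_iff.1 (one_pos.trans_le (hx k))
  have h2 : y k ≠ 0 := norm_pos_iff.1 (one_pos.trans_le (hy k))
  field_simp
  ring

theorem BddClose.star {x y : ℕ → ℂ} (h : BddClose x y) :
    BddClose (fun k => (starRingEnd ℂ) (x k)) (fun k => (starRingEnd ℂ) (y k)) := by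
  refine ⟨by simpa using h.left, by simpa using h.right, ?_⟩
  have := (Complex.continuous_conj.tendsto 0).comp h.tendsto
  simpa [Function.comp_def] using this

/-- If uniformity failed for some `ε`, a sequence of bad points would contradict the right-hand
side. -/
theorem tendstoUniformlyOn_zero_iff_seq {Z : Type*} {K : Set Z} {h : ℕ → Z → G} :
    TendstoUniformlyOn h (fun _ => 0) atTop K ↔
      ∀ z : ℕ → Z, (∀ k, z k ∈ K) → Tendsto (fun k => h k (z k)) atTop (𝓝 0) := by
  simp only [Metric.tendstoUniformlyOn_iff, dist_zero_left]
  constructor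
  · intro H z hz
    rw [Metric.tendsto_nhds]
    intro ε hε
    filter_upwards [H ε hε] with k hk
    simpa using hk _ (hz k)
  · intro H ε hε
    rcases K.eq_empty_or_nonempty with rfl | ⟨z₀, hz₀⟩
    · simp
    -- Choose a bad point whenever one exists; `z₀` is the default value for the other indices.
    have : ∀ k, ∃ z ∈ K, (∃ w ∈ K, ε ≤ ‖h k w‖) → ε ≤ ‖h k z‖ := by
      intro k
      by_cases hk : ∃ w ∈ K, ε ≤ ‖h k w‖
      · obtain ⟨w, hw, hw'⟩ := hk
        exact ⟨w, hw, fun _ => hw'⟩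
      · exact ⟨z₀, hz₀, fun h => absurd h hk⟩
    choose z hz hzε using this
    have hlim := Metric.tendsto_nhds.1 (H z hz) ε hε
    filter_upwards [hlim] with k hk x hx
    by_contra! hcon
    rw [dist_zero_right] at hk
    exact absurd (hzε k ⟨x, hx, hcon⟩) (not_le.2 hk)

theorem Setting.tendsToZeroOnCompacts_iff {O : Setting} {h : ℕ → ℂ → ℂ} :
    O.TendsToZeroOnCompacts h ↔
      ∀ z : ℕ → ℂ, PrecompactIn O.domain z → Tendsto (fun k => h k (z k)) atTop (𝓝 0) := by
  constructor
  · rintro H z ⟨K, hK, hKO, hz⟩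
    exact tendstoUniformlyOn_zero_iff_seq.1 (H K hK hKO) z hz
  · intro H K hK hKO
    exact tendstoUniformlyOn_zero_iff_seq.2 fun z hz => H z ⟨K, hK, hKO, hz⟩

/-- An equibounded, pointwise null sequence of functionals is null along precompact sequences. -/
theorem tendsto_functional_of_precompact [NormedSpace ℂ E] (L : ℕ → E →ₗ[ℂ] ℂ) {C : ℝ}
    (hC : ∀ k x, ‖L k x‖ ≤ C * ‖x‖) (hL : ∀ x, Tendsto (fun k => L k x) atTop (𝓝 0))
    {U : Set E} {x : ℕ → E} (hx : PrecompactIn U x) :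
    Tendsto (fun k => L k (x k)) atTop (𝓝 0) := by
  obtain ⟨K, hK, -, hx⟩ := hx
  -- Along a subsequence with `x → a`, split `L x = L (x - a) + L a`: the bound handles the first
  -- term, the pointwise hypothesis the second.
  refine tendsto_of_subseq_tendsto fun ns hns => ?_
  obtain ⟨a, -, ms, hmono, hms⟩ := hK.tendsto_subseq (x := fun n => x (ns n)) (fun n => hx _)
  have hms' : Tendsto ms atTop atTop := hmono.tendsto_atTop
  refine ⟨ms, ?_⟩
  have h1 : Tendsto (fun n => L (ns (ms n)) (x (ns (ms n)) - a)) atTop (𝓝 0) := by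
    refine squeeze_zero_norm (fun n => hC _ _) ?_
    have := ((tendsto_iff_norm_sub_tendsto_zero.1 hms).const_mul C)
    simpa using this
  have h2 : Tendsto (fun n => L (ns (ms n)) a) atTop (𝓝 0) :=
    (hL a).comp (hns.comp hms')
  have := h1.add h2
  rw [add_zero] at this
  exact this.congr fun n => by rw [map_sub]; ring

/-- The vectors on which an equibounded sequence of functionals tends to zero. -/
def nullSubspace [NormedSpace ℂ E] (L : ℕ → E →ₗ[ℂ] ℂ) : Submodule ℂ E where
  carrier := {x | Tendsto (fun k => L k x) atTop (𝓝 0)}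
  add_mem' {x y} hx hy := by
    simpa using Filter.Tendsto.add hx hy
  zero_mem' := by simp
  smul_mem' c x hx := by
    simpa using Filter.Tendsto.const_mul c hx

theorem isClosed_nullSubspace [NormedSpace ℂ E] (L : ℕ → E →ₗ[ℂ] ℂ) {C : ℝ}
    (hC : ∀ k x, ‖L k x‖ ≤ C * ‖x‖) : IsClosed (nullSubspace L : Set E) := by
  rw [← isSeqClosed_iff_isClosed]
  intro x a hx hxa
  change Tendsto (fun k => L k a) atTop (𝓝 0)
  have hlim : Tendsto (fun n => C * ‖x n - a‖) atTop (𝓝 0) := by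
    simpa using (tendsto_iff_norm_sub_tendsto_zero.1 hxa).const_mul C
  rw [Metric.tendsto_nhds]
  intro ε hε
  obtain ⟨n, hn⟩ := (hlim.eventually (gt_mem_nhds (half_pos hε))).exists
  have hxn : Tendsto (fun k => L k (x n)) atTop (𝓝 0) := hx n
  filter_upwards [Metric.tendsto_nhds.1 hxn (ε / 2) (half_pos hε)] with k hk
  rw [dist_zero_right] at hk ⊢
  have h1 := hC k (x n - a)
  have h2 : L k a = L k (x n) - L k (x n - a) := by rw [map_sub]; ring
  rw [h2]
  have := norm_sub_le (L k (x n)) (L k (x n - a))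
  linarith

end Sequences

/-! ### Kernels on a compact space with a unimodular coordinate -/

section Kernels

variable {X : Type*} [TopologicalSpace X]

local notation "𝔹" => Metric.ball (0 : ℂ) 1
local notation "conj" => starRingEnd ℂ

/-- The Cauchy kernel `1 / (τ - w)`. -/
noncomputable def cauchyKernel (τ : C(X, ℂ)) (w : ℂ) : C(X, ℂ) :=
  Ring.inverse (τ - algebraMap ℂ C(X, ℂ) w)

/-- The kernel `(1 - \bar a τ) / (τ - w)`. -/
noncomputable def schurKernel (τ : C(X, ℂ)) (p : ℂ × ℂ) : C(X, ℂ) :=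
  (1 - conj p.1 • τ) * cauchyKernel τ p.2

/-- The Carathéodory kernel, normalized to be `1` at `w = a`. -/
noncomputable def caraKernel (τ : C(X, ℂ)) (p : ℂ × ℂ) : C(X, ℂ) :=
  1 + (2 * (p.2 - p.1) / (1 - p.1 * conj p.1)) • schurKernel τ p

/-- The reciprocal of the Poisson kernel. -/
noncomputable def poissonInv (τ : C(X, ℂ)) (a : ℂ) : C(X, ℂ) :=
  (1 / (1 - a * conj a)) •
    ((τ - algebraMap ℂ C(X, ℂ) a) * star (τ - algebraMap ℂ C(X, ℂ) a))

/-- The Poisson kernel. -/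
noncomputable def poissonKernel (τ : C(X, ℂ)) (a : ℂ) : C(X, ℂ) :=
  (1 - a * conj a) • (cauchyKernel τ a * star (cauchyKernel τ a))

variable {τ : C(X, ℂ)}

theorem coord_ne (hτ : ∀ t, ‖τ t‖ = 1) {w : ℂ} (hw : w ∈ 𝔹) (t : X) : τ t - w ≠ 0 := by
  intro h
  rw [mem_ball_zero_iff, ← sub_eq_zero.1 h, hτ] at hw
  exact lt_irrefl _ hw

theorem isUnit_coord_sub (hτ : ∀ t, ‖τ t‖ = 1) {w : ℂ} (hw : w ∈ 𝔹) :
    IsUnit (τ - algebraMap ℂ C(X, ℂ) w) :=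
  (ContinuousMap.isUnit_iff_forall_ne_zero _).2 fun t => coord_ne hτ hw t

theorem cauchyKernel_apply (hτ : ∀ t, ‖τ t‖ = 1) {w : ℂ} (hw : w ∈ 𝔹) (t : X) :
    cauchyKernel τ w t = (τ t - w)⁻¹ := by
  have h := congrArg (fun f : C(X, ℂ) => f t)
    (Ring.inverse_mul_cancel _ (isUnit_coord_sub hτ hw))
  exact eq_inv_of_mul_eq_one_left h

theorem one_sub_mul_conj_ne {a w : ℂ} (ha : a ∈ 𝔹) (hw : w ∈ 𝔹) : 1 - a * conj w ≠ 0 := by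
  rw [mem_ball_zero_iff] at ha hw
  intro h
  have : ‖a * conj w‖ = 1 := by rw [← sub_eq_zero.1 h, norm_one]
  rw [norm_mul, RCLike.norm_conj] at this
  nlinarith [norm_nonneg a, norm_nonneg w]

theorem coord_mul_conj (hτ : ∀ t, ‖τ t‖ = 1) (t : X) : τ t * conj (τ t) = 1 := by
  rw [Complex.mul_conj, Complex.normSq_eq_norm_sq, hτ]
  norm_num

theorem conj_coord (hτ : ∀ t, ‖τ t‖ = 1) (t : X) : conj (τ t) = (τ t)⁻¹ :=
  eq_inv_of_mul_eq_one_right (coord_mul_conj hτ t)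

theorem coord_ne_zero (hτ : ∀ t, ‖τ t‖ = 1) (t : X) : τ t ≠ 0 :=
  norm_ne_zero_iff.1 (by rw [hτ]; exact one_ne_zero)

theorem one_sub_conj_mul_coord_ne (hτ : ∀ t, ‖τ t‖ = 1) {a : ℂ} (ha : a ∈ 𝔹) (t : X) :
    1 - conj a * τ t ≠ 0 := by
  intro h
  have h1 : conj (τ t - a) = 0 := by
    rw [map_sub, conj_coord hτ]
    have := coord_ne_zero hτ t
    field_simp
    linear_combination h
  exact coord_ne hτ ha t ((map_eq_zero _).1 h1)

theorem schurKernel_apply (hτ : ∀ t, ‖τ t‖ = 1) (a : ℂ) {w : ℂ} (hw : w ∈ 𝔹) (t : X) :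
    schurKernel τ (a, w) t = (1 - conj a * τ t) / (τ t - w) := by
  simp [schurKernel, cauchyKernel_apply hτ hw, div_eq_mul_inv]

theorem caraKernel_apply (hτ : ∀ t, ‖τ t‖ = 1) (a : ℂ) {w : ℂ} (hw : w ∈ 𝔹) (t : X) :
    caraKernel τ (a, w) t =
      1 + 2 * (w - a) / (1 - a * conj a) * ((1 - conj a * τ t) / (τ t - w)) := by
  simp [caraKernel, schurKernel_apply hτ a hw]

theorem poissonInv_apply (a : ℂ) (t : X) :
    poissonInv τ a t = (τ t - a) * conj (τ t - a) / (1 - a * conj a) := by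
  simp only [poissonInv, ContinuousMap.smul_apply, ContinuousMap.mul_apply,
    ContinuousMap.star_apply, smul_eq_mul, RCLike.star_def]
  exact one_div_mul_eq_div _ _

theorem poissonKernel_apply (hτ : ∀ t, ‖τ t‖ = 1) {a : ℂ} (ha : a ∈ 𝔹) (t : X) :
    poissonKernel τ a t = (1 - a * conj a) / ((τ t - a) * conj (τ t - a)) := by
  simp only [poissonKernel, ContinuousMap.smul_apply, ContinuousMap.mul_apply,
    ContinuousMap.star_apply, smul_eq_mul, RCLike.star_def, cauchyKernel_apply hτ ha, map_inv₀]
  rw [← mul_inv, div_eq_mul_inv]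

theorem poissonInv_mul_poissonKernel (hτ : ∀ t, ‖τ t‖ = 1) {a : ℂ} (ha : a ∈ 𝔹) :
    poissonInv τ a * poissonKernel τ a = 1 := by
  ext t
  have h1 := coord_ne hτ ha t
  have h2 : conj (τ t - a) ≠ 0 := (map_ne_zero _).2 h1
  have h3 := one_sub_mul_conj_ne ha ha
  rw [ContinuousMap.mul_apply, poissonInv_apply, poissonKernel_apply hτ ha,
    ContinuousMap.one_apply]
  field_simp

/-- The normalizing imaginary term does not depend on `w` and cancels; what remains is `(τ + w)/(τ -
w) - 1 = 2w/(τ - w)` times the weight. -/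
theorem caraKernel_sub_caraKernel_zero (hτ : ∀ t, ‖τ t‖ = 1) {a w : ℂ} (ha : a ∈ 𝔹)
    (hw : w ∈ 𝔹) :
    caraKernel τ (a, w) - caraKernel τ (a, 0) =
      (2 * w) • (poissonInv τ a * cauchyKernel τ w) := by
  ext t
  have h0 : (0 : ℂ) ∈ 𝔹 := by simp
  have h1 := coord_ne hτ hw t
  have h2 := coord_ne_zero hτ t
  have h3 := one_sub_mul_conj_ne ha ha
  simp only [ContinuousMap.sub_apply, ContinuousMap.smul_apply, ContinuousMap.mul_apply,
    smul_eq_mul, caraKernel_apply hτ a hw, caraKernel_apply hτ a h0, poissonInv_apply,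
    cauchyKernel_apply hτ hw, map_sub, conj_coord hτ, sub_zero]
  field_simp
  ring

theorem caraKernel_zero_add_star (hτ : ∀ t, ‖τ t‖ = 1) {a : ℂ} (ha : a ∈ 𝔹) :
    caraKernel τ (a, 0) + star (caraKernel τ (a, 0)) = (2 : ℂ) • poissonInv τ a := by
  ext t
  have h0 : (0 : ℂ) ∈ 𝔹 := by simp
  have h2 := coord_ne_zero hτ t
  have h3 := one_sub_mul_conj_ne ha ha
  have h4 : 1 - conj a * a ≠ 0 := by rwa [mul_comm]
  simp only [ContinuousMap.add_apply, ContinuousMap.smul_apply, ContinuousMap.star_apply,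
    smul_eq_mul, caraKernel_apply hτ a h0, poissonInv_apply, RCLike.star_def, map_add, map_mul,
    map_div₀, map_one, map_sub, Complex.conj_conj, conj_coord hτ, sub_zero, map_ofNat,
    map_zero]
  field_simp
  ring

/-- The real part is the quotient of the Poisson kernels at `w` and at `a`. -/
theorem caraKernel_re_nonneg (hτ : ∀ t, ‖τ t‖ = 1) {a w : ℂ} (ha : a ∈ 𝔹) (hw : w ∈ 𝔹)
    (t : X) : 0 ≤ (caraKernel τ (a, w) t).re := by
  have h1 := coord_ne hτ hw t
  have h1' : 1 - τ t * conj w ≠ 0 := by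
    rw [mul_comm]
    exact one_sub_conj_mul_coord_ne hτ hw t
  have h2 := coord_ne_zero hτ t
  have h3 := one_sub_mul_conj_ne ha ha
  have h4 : 1 - conj a * a ≠ 0 := by rwa [mul_comm]
  have key : ((2 * (caraKernel τ (a, w) t).re : ℝ) : ℂ) =
      ((2 * ((1 - ‖w‖ ^ 2) / (1 - ‖a‖ ^ 2) * (‖τ t - a‖ ^ 2 / ‖τ t - w‖ ^ 2)) : ℝ) : ℂ) := by
    rw [← Complex.add_conj, caraKernel_apply hτ a hw]
    push_cast
    simp only [← Complex.mul_conj', map_add, map_mul, map_div₀, map_one, map_sub,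
      Complex.conj_conj, conj_coord hτ, map_ofNat]
    have h5 : (τ t)⁻¹ - conj w ≠ 0 := by
      rw [← conj_coord hτ, ← map_sub]
      exact (map_ne_zero _).2 h1
    field_simp
    ring
  have key' := Complex.ofReal_injective key
  rw [mem_ball_zero_iff] at ha hw
  have e1 : 0 ≤ 1 - ‖w‖ ^ 2 := by nlinarith [norm_nonneg w]
  have e2 : 0 ≤ 1 - ‖a‖ ^ 2 := by nlinarith [norm_nonneg a]
  have : 0 ≤ (1 - ‖w‖ ^ 2) / (1 - ‖a‖ ^ 2) * (‖τ t - a‖ ^ 2 / ‖τ t - w‖ ^ 2) := by positivity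
  linarith

theorem cauchyKernel_zero (hτ : ∀ t, ‖τ t‖ = 1) : cauchyKernel τ 0 = star τ := by
  ext t
  rw [cauchyKernel_apply hτ (by simp), ContinuousMap.star_apply, RCLike.star_def, conj_coord hτ,
    sub_zero]

/-- One step of the geometric expansion of `1/(τ - w)`; iterating it extracts the powers of `star
τ`. -/
theorem cauchyKernel_eq (hτ : ∀ t, ‖τ t‖ = 1) {w : ℂ} (hw : w ∈ 𝔹) :
    cauchyKernel τ w = star τ + w • (star τ * cauchyKernel τ w) := by
  ext t
  have h1 := coord_ne hτ hw t
  have h2 := coord_ne_zero hτ t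
  simp only [ContinuousMap.add_apply, ContinuousMap.smul_apply, ContinuousMap.star_apply,
    ContinuousMap.mul_apply, smul_eq_mul, cauchyKernel_apply hτ hw, RCLike.star_def,
    conj_coord hτ]
  field_simp
  ring

/-! ### Continuity of the kernels in their parameters, and density of the Cauchy kernels -/

variable [CompactSpace X]

/-- Inversion is continuous at units of the Banach algebra `C(X, ℂ)`, which gives continuity in sup
norm at once. -/
theorem continuousOn_cauchyKernel (hτ : ∀ t, ‖τ t‖ = 1) :
    ContinuousOn (cauchyKernel τ) 𝔹 := by
  intro w hw
  obtain ⟨u, hu⟩ := isUnit_coord_sub hτ hw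
  have h := NormedRing.inverse_continuousAt u
  rw [hu] at h
  have h2 : Continuous fun w : ℂ => τ - algebraMap ℂ C(X, ℂ) w :=
    continuous_const.sub (continuous_algebraMap ℂ _)
  exact (ContinuousAt.comp (f := fun w : ℂ => τ - algebraMap ℂ C(X, ℂ) w) h
    h2.continuousAt).continuousWithinAt

theorem continuousOn_schurKernel (hτ : ∀ t, ‖τ t‖ = 1) :
    ContinuousOn (schurKernel τ) (𝔹 ×ˢ 𝔹) := by
  have h1 : Continuous fun p : ℂ × ℂ => (1 - conj p.1 • τ : C(X, ℂ)) :=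
    continuous_const.sub ((Complex.continuous_conj.comp continuous_fst).smul continuous_const)
  exact h1.continuousOn.mul ((continuousOn_cauchyKernel hτ).comp continuousOn_snd
    fun p hp => hp.2)

theorem continuousOn_caraKernel (hτ : ∀ t, ‖τ t‖ = 1) :
    ContinuousOn (caraKernel τ) (𝔹 ×ˢ 𝔹) := by
  have h : ContinuousOn (fun p : ℂ × ℂ => 2 * (p.2 - p.1) / (1 - p.1 * conj p.1)) (𝔹 ×ˢ 𝔹) := by
    refine ContinuousOn.div (by fun_prop) ?_ fun p hp => one_sub_mul_conj_ne hp.1 hp.1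
    exact (continuous_const.sub (continuous_fst.mul
      (Complex.continuous_conj.comp continuous_fst))).continuousOn
  exact continuousOn_const.add (h.smul (continuousOn_schurKernel hτ))

theorem continuousOn_poissonInv : ContinuousOn (poissonInv τ) 𝔹 := by
  have h2 : Continuous fun w : ℂ => τ - algebraMap ℂ C(X, ℂ) w :=
    continuous_const.sub (continuous_algebraMap ℂ _)
  have h : ContinuousOn (fun a : ℂ => 1 / (1 - a * conj a)) 𝔹 :=
    continuousOn_const.div
      (continuous_const.sub (continuous_id.mul Complex.continuous_conj)).continuousOn
      fun a ha => one_sub_mul_conj_ne ha ha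
  exact h.smul (h2.mul h2.star).continuousOn

theorem continuousOn_poissonKernel (hτ : ∀ t, ‖τ t‖ = 1) :
    ContinuousOn (poissonKernel τ) 𝔹 := by
  have h : Continuous fun a : ℂ => 1 - a * conj a :=
    continuous_const.sub (continuous_id.mul Complex.continuous_conj)
  exact h.continuousOn.smul ((continuousOn_cauchyKernel hτ).mul
    (continuousOn_cauchyKernel hτ).star)

/-- A closed self-adjoint subspace containing `1` and the Cauchy kernels of all `w ≠ 0` is
everything. -/
theorem eq_top_of_cauchyKernel_mem (hτ : ∀ t, ‖τ t‖ = 1) (hinj : Function.Injective τ)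
    (V : Submodule ℂ C(X, ℂ)) (hV : IsClosed (V : Set C(X, ℂ)))
    (hstar : ∀ φ ∈ V, star φ ∈ V) (hone : 1 ∈ V)
    (hw : ∀ w ∈ 𝔹, w ≠ 0 → cauchyKernel τ w ∈ V) : V = ⊤ := by
  have h0 : (0 : ℂ) ∈ 𝔹 := by simp
  -- Since `V` is closed, letting `w → 0` supplies the missing value.
  have hfill : ∀ ψ : C(X, ℂ), (∀ w ∈ 𝔹, w ≠ 0 → ψ * cauchyKernel τ w ∈ V) →
      ∀ w ∈ 𝔹, ψ * cauchyKernel τ w ∈ V := by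
    intro ψ hψ w hwb
    by_cases hw0 : w = 0
    · subst hw0
      have hc : ContinuousAt (fun w => ψ * cauchyKernel τ w) 0 :=
        continuousAt_const.mul ((continuousOn_cauchyKernel hτ).continuousAt
          (Metric.isOpen_ball.mem_nhds h0))
      refine hV.mem_of_tendsto (hc.tendsto.mono_left nhdsWithin_le_nhds :
        Tendsto _ (𝓝[≠] (0 : ℂ)) _) ?_
      filter_upwards [self_mem_nhdsWithin,
        mem_nhdsWithin_of_mem_nhds (Metric.isOpen_ball.mem_nhds h0)] with w hw0 hwb
      exact hψ w hwb hw0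
    · exact hψ w hwb hw0
  -- Inductive step: subtract the value at `w = 0`, which is `star τ ^ (n + 1)`, and divide by `w`.
  have hpow : ∀ n : ℕ, ∀ w ∈ 𝔹, star τ ^ n * cauchyKernel τ w ∈ V := by
    intro n
    induction n with
    | zero => exact hfill _ (by simpa using hw)
    | succ n ih =>
      refine hfill _ fun w hwb hw0 => ?_
      have h1 : star τ ^ (n + 1) ∈ V := by
        have := ih 0 h0
        rwa [cauchyKernel_zero hτ, ← pow_succ] at this
      have h2 := V.smul_mem w⁻¹ (V.sub_mem (ih w hwb) h1)
      convert h2 using 1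
      conv_rhs => rw [cauchyKernel_eq hτ hwb]
      rw [mul_add, ← pow_succ, add_sub_cancel_left, mul_smul_comm, smul_smul,
        inv_mul_cancel₀ hw0, one_smul, ← mul_assoc, ← pow_succ]
  have hneg : ∀ n : ℕ, star τ ^ n ∈ V := by
    rintro (_ | n)
    · simpa using hone
    · have := hpow n 0 h0
      rwa [cauchyKernel_zero hτ, ← pow_succ] at this
  have hpos : ∀ n : ℕ, τ ^ n ∈ V := by
    intro n
    have := hstar _ (hneg n)
    rwa [star_pow, star_star] at this
  have hmul : τ * star τ = 1 := by
    ext t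
    exact coord_mul_conj hτ t
  -- As `τ * star τ = 1`, each monomial in `τ` and `star τ` reduces to a pure power of one of them.
  have hle : ((StarAlgebra.adjoin ℂ {τ} : StarSubalgebra ℂ C(X, ℂ)) : Set C(X, ℂ)) ⊆ V := by
    intro φ hφ
    have hφ' : φ ∈ Subalgebra.toSubmodule
        (StarAlgebra.adjoin ℂ {τ} : StarSubalgebra ℂ C(X, ℂ)).toSubalgebra := hφ
    rw [StarAlgebra.adjoin_toSubalgebra, Algebra.adjoin_eq_span] at hφ'
    refine Submodule.span_le.2 ?_ hφ'
    intro x hx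
    rw [Set.star_singleton, Set.singleton_union] at hx
    obtain ⟨m, n, rfl⟩ := (Submonoid.mem_closure_pair _ _ _).1 hx
    rcases le_total m n with h | h
    · obtain ⟨j, rfl⟩ := Nat.exists_eq_add_of_le h
      rw [pow_add, ← mul_assoc, ← mul_pow, hmul, one_pow, one_mul]
      exact hneg j
    · obtain ⟨j, rfl⟩ := Nat.exists_eq_add_of_le h
      rw [pow_add, mul_right_comm, ← mul_pow, hmul, one_pow, one_mul]
      exact hpos j
  have hsep : (StarAlgebra.adjoin ℂ {τ} : StarSubalgebra ℂ C(X, ℂ)).SeparatesPoints := by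
    intro x y hxy
    exact ⟨τ, ⟨τ, StarAlgebra.subset_adjoin ℂ _ rfl, rfl⟩, fun h => hxy (hinj h)⟩
  have htop := ContinuousMap.starSubalgebra_topologicalClosure_eq_top_of_separatesPoints _ hsep
  rw [eq_top_iff]
  intro φ _
  have : φ ∈ (StarAlgebra.adjoin ℂ {τ} : StarSubalgebra ℂ C(X, ℂ)).topologicalClosure := by
    rw [htop]; trivial
  exact closure_minimal hle hV this

/-! ### Integration against probability measures -/

variable [MeasurableSpace X] [BorelSpace X]

theorem integrable_continuousMap (μ : Measure X) [IsFiniteMeasure μ] (φ : C(X, ℂ)) :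
    Integrable φ μ :=
  (BoundedContinuousFunction.mkOfCompact φ).integrable μ

/-- Integration of continuous functions, as a linear functional. -/
noncomputable def integralFunctional (μ : Measure X) [IsFiniteMeasure μ] : C(X, ℂ) →ₗ[ℂ] ℂ where
  toFun φ := ∫ t, φ t ∂μ
  map_add' φ ψ := integral_add (integrable_continuousMap μ φ) (integrable_continuousMap μ ψ)
  map_smul' c φ := integral_const_mul c φ

theorem norm_integralFunctional_le (μ : Measure X) [IsProbabilityMeasure μ] (φ : C(X, ℂ)) :
    ‖integralFunctional μ φ‖ ≤ ‖φ‖ := by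
  have := norm_integral_le_of_norm_le_const (μ := μ) (ae_of_all μ fun t => φ.norm_coe_le_norm t)
  simpa [integralFunctional] using this

theorem integralFunctional_one (μ : Measure X) [IsProbabilityMeasure μ] :
    integralFunctional μ (1 : C(X, ℂ)) = 1 := by
  simp [integralFunctional]

theorem integralFunctional_star (μ : Measure X) [IsFiniteMeasure μ] (φ : C(X, ℂ)) :
    integralFunctional μ (star φ) = conj (integralFunctional μ φ) :=
  integral_conj

theorem continuous_integralFunctional (μ : Measure X) [IsProbabilityMeasure μ] :
    Continuous (integralFunctional μ) :=
  AddMonoidHomClass.continuous_of_bound (integralFunctional μ) 1 fun φ => by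
    simpa using norm_integralFunctional_le μ φ

theorem PrecompactIn.integral_bdd {U : Set C(X, ℂ)} {φ : ℕ → C(X, ℂ)} (h : PrecompactIn U φ)
    (μ : ℕ → Measure X) [∀ k, IsProbabilityMeasure (μ k)] :
    ∃ C, ∀ k, ‖integralFunctional (μ k) (φ k)‖ ≤ C := by
  obtain ⟨C, hC⟩ := h.bdd
  exact ⟨C, fun k => (norm_integralFunctional_le _ _).trans (hC k)⟩

/-! ### Weak-* convergence against varying test functions -/

section Convergence

variable {μ ν : ℕ → Measure X} [∀ k, IsProbabilityMeasure (μ k)]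
  [∀ k, IsProbabilityMeasure (ν k)]

/-- Insert `∫ φ_k dν_k`: the measures are compared on a precompact sequence, then the test functions
in sup norm. -/
theorem tendsto_integral_sub_of_close {U : Set C(X, ℂ)} {φ ψ : ℕ → C(X, ℂ)}
    (hφ : PrecompactIn U φ) (hclose : Tendsto (fun k => φ k - ψ k) atTop (𝓝 0))
    (h : ∀ χ : C(X, ℂ), Tendsto
      (fun k => integralFunctional (μ k) χ - integralFunctional (ν k) χ) atTop (𝓝 0)) :
    Tendsto (fun k => integralFunctional (μ k) (φ k) - integralFunctional (ν k) (ψ k))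
      atTop (𝓝 0) := by
  have h1 : Tendsto (fun k => (integralFunctional (μ k) - integralFunctional (ν k)) (φ k))
      atTop (𝓝 0) := by
    refine tendsto_functional_of_precompact _ (C := 2) (fun k x => ?_) h hφ
    refine (norm_sub_le _ _).trans ?_
    have := norm_integralFunctional_le (μ k) x
    have := norm_integralFunctional_le (ν k) x
    linarith
  have h2 : Tendsto (fun k => integralFunctional (ν k) (φ k - ψ k)) atTop (𝓝 0) :=
    squeeze_zero_norm (fun k => norm_integralFunctional_le _ _)
      (by simpa using hclose.norm)
  have := h1.add h2
  rw [add_zero] at this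
  refine this.congr fun k => ?_
  rw [map_sub, LinearMap.sub_apply]
  ring

/-- Pointwise convergence of the differences of the normalized Carathéodory functions implies
weak-* convergence of the differences of the measures. -/
theorem tendsto_integral_sub_of_cara (hτ : ∀ t, ‖τ t‖ = 1) (hinj : Function.Injective τ)
    {a b : ℕ → ℂ} (ha : PrecompactIn 𝔹 a) (hb : PrecompactIn 𝔹 b)
    (hab : Tendsto (fun k => a k - b k) atTop (𝓝 0))
    (h : ∀ w ∈ 𝔹, Tendsto (fun k => integralFunctional (μ k) (caraKernel τ (a k, w)) -
      integralFunctional (ν k) (caraKernel τ (b k, w))) atTop (𝓝 0)) (φ : C(X, ℂ)) :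
    Tendsto (fun k => integralFunctional (μ k) φ - integralFunctional (ν k) φ) atTop (𝓝 0) := by
  have h0 : (0 : ℂ) ∈ 𝔹 := by simp
  -- The difference of the measures weighted by their own reciprocal Poisson kernels.
  let L : ℕ → C(X, ℂ) →ₗ[ℂ] ℂ := fun k =>
    integralFunctional (μ k) ∘ₗ LinearMap.mulLeft ℂ (poissonInv τ (a k)) -
      integralFunctional (ν k) ∘ₗ LinearMap.mulLeft ℂ (poissonInv τ (b k))
  have hL : ∀ k φ, L k φ = integralFunctional (μ k) (poissonInv τ (a k) * φ) -
      integralFunctional (ν k) (poissonInv τ (b k) * φ) := fun k φ => rfl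
  obtain ⟨C₁, hC₁⟩ := ha.bdd_comp (continuousOn_poissonInv (τ := τ))
  obtain ⟨C₂, hC₂⟩ := hb.bdd_comp (continuousOn_poissonInv (τ := τ))
  have hbound : ∀ k φ, ‖L k φ‖ ≤ (C₁ + C₂) * ‖φ‖ := by
    intro k φ
    rw [hL, add_mul]
    refine (norm_sub_le _ _).trans (add_le_add ?_ ?_)
    · exact (norm_integralFunctional_le _ _).trans ((norm_mul_le _ _).trans
        (mul_le_mul_of_nonneg_right (hC₁ k) (norm_nonneg _)))
    · exact (norm_integralFunctional_le _ _).trans ((norm_mul_le _ _).trans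
        (mul_le_mul_of_nonneg_right (hC₂ k) (norm_nonneg _)))
  have hself : ∀ c, star (poissonInv τ c) = poissonInv τ c := by
    intro c
    ext t
    simp only [ContinuousMap.star_apply, poissonInv_apply, RCLike.star_def, map_div₀, map_mul,
      map_sub, map_one, Complex.conj_conj]
    ring
  have hLstar : ∀ k φ, L k (star φ) = conj (L k φ) := by
    intro k φ
    have : ∀ c, poissonInv τ c * star φ = star (poissonInv τ c * φ) := fun c => by
      rw [star_mul, hself, mul_comm]
    rw [hL, hL, this, this, integralFunctional_star, integralFunctional_star, map_sub]
  have htop : nullSubspace L = ⊤ := by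
    refine eq_top_of_cauchyKernel_mem hτ hinj _ (isClosed_nullSubspace L hbound) ?_ ?_ ?_
    · intro φ hφ
      have := (Complex.continuous_conj.tendsto 0).comp (show Tendsto _ _ _ from hφ)
      rw [map_zero] at this
      exact this.congr fun k => (hLstar k φ).symm
    -- The mass of the weighted measure is the real part of the Carathéodory function at `0`, hence
    -- the average with the conjugate.
    · have h1 := h 0 h0
      have h2 := (Complex.continuous_conj.tendsto 0).comp h1
      rw [map_zero] at h2
      have h3 := (h1.add h2).const_mul (1 / 2)
      rw [add_zero, mul_zero] at h3
      refine h3.congr fun k => ?_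
      have e : ∀ (ρ : Measure X) [IsFiniteMeasure ρ] (c : ℂ), c ∈ 𝔹 →
          integralFunctional ρ (caraKernel τ (c, 0)) +
            conj (integralFunctional ρ (caraKernel τ (c, 0))) =
          2 * integralFunctional ρ (poissonInv τ c) := by
        intro ρ _ c hc
        rw [← integralFunctional_star, ← map_add, caraKernel_zero_add_star hτ hc, map_smul,
          smul_eq_mul]
      rw [hL, mul_one, mul_one, Function.comp_apply, map_sub]
      linear_combination (1 / 2) * e (μ k) (a k) (ha.mem k) - (1 / 2) * e (ν k) (b k) (hb.mem k)
    · intro w hw hw0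
      have h1 := ((h w hw).sub (h 0 h0)).const_mul (1 / (2 * w))
      rw [sub_zero, mul_zero] at h1
      refine h1.congr fun k => ?_
      have e : ∀ (ρ : Measure X) [IsFiniteMeasure ρ] (c : ℂ), c ∈ 𝔹 →
          integralFunctional ρ (caraKernel τ (c, w)) - integralFunctional ρ (caraKernel τ (c, 0)) =
          2 * w * integralFunctional ρ (poissonInv τ c * cauchyKernel τ w) := by
        intro ρ _ c hc
        rw [← map_sub, caraKernel_sub_caraKernel_zero hτ hc hw, map_smul, smul_eq_mul]
      have e1 := e (μ k) (a k) (ha.mem k)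
      have e2 := e (ν k) (b k) (hb.mem k)
      rw [hL]
      field_simp
      linear_combination e1 - e2
  have hnull : ∀ ψ, Tendsto (fun k => L k ψ) atTop (𝓝 0) := by
    intro ψ
    have : ψ ∈ nullSubspace L := by rw [htop]; trivial
    exact this
  -- This test function cancels the weight of `μ k` exactly; that of `ν k` it cancels up to an error
  -- from `a k ≠ b k`, which `h2` shows to be negligible.
  have h1 : Tendsto (fun k => L k (φ * poissonKernel τ (a k))) atTop (𝓝 0) :=
    tendsto_functional_of_precompact L hbound hnull
      (ha.image (continuousOn_const.mul (continuousOn_poissonKernel hτ))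
        (Set.mapsTo_univ _ _))
  have hP := (ha.bddClose hb hab (continuousOn_poissonKernel hτ)).tendsto
  have h2 : Tendsto (fun k => integralFunctional (ν k) (φ * poissonInv τ (b k) *
      (poissonKernel τ (a k) - poissonKernel τ (b k)))) atTop (𝓝 0) := by
    refine squeeze_zero_norm (a := fun k => ‖φ‖ * C₂ *
      ‖poissonKernel τ (a k) - poissonKernel τ (b k)‖) (fun k => ?_) ?_
    · refine (norm_integralFunctional_le _ _).trans ((norm_mul_le _ _).trans
        (mul_le_mul_of_nonneg_right ((norm_mul_le _ _).trans
          (mul_le_mul_of_nonneg_left (hC₂ k) (norm_nonneg _))) (norm_nonneg _)))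
    · simpa using hP.norm.const_mul (‖φ‖ * C₂)
  have h3 := h1.add h2
  rw [add_zero] at h3
  refine h3.congr fun k => ?_
  have e1 : poissonInv τ (a k) * (φ * poissonKernel τ (a k)) = φ := by
    rw [mul_left_comm, poissonInv_mul_poissonKernel hτ (ha.mem k), mul_one]
  have e2 : φ * poissonInv τ (b k) * (poissonKernel τ (a k) - poissonKernel τ (b k)) =
      poissonInv τ (b k) * (φ * poissonKernel τ (a k)) - φ := by
    rw [mul_sub, mul_assoc φ (poissonInv τ (b k)) (poissonKernel τ (b k)),
      poissonInv_mul_poissonKernel hτ (hb.mem k)]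
    ring
  rw [hL, e1, e2, map_sub]
  ring

end Convergence

end Kernels

local notation "𝔹" => Metric.ball (0 : ℂ) 1
local notation "conj" => starRingEnd ℂ

namespace Setting

/-! ### The two settings -/

instance (O : Setting) : CompactSpace O.Boundary :=
  match O with
  | disk => inferInstanceAs (CompactSpace Circle)
  | halfPlane => inferInstanceAs (CompactSpace (OnePoint ℝ))

/-- The conformal map `ζ₀` of the domain onto the disk. -/
noncomputable def toDisk (O : Setting) (z : ℂ) : ℂ := O.zeta O.base z

theorem toDisk_disk (z : ℂ) : disk.toDisk z = z := by
  simp [toDisk, zeta, zconst, varpi, base]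

theorem toDisk_halfPlane (z : ℂ) : halfPlane.toDisk z = (z - I) / (z + I) := by
  simp [toDisk, zeta, zconst, varpi, base]

theorem zetaBdry_disk (t : Circle) : disk.zetaBdry t = (t : ℂ) := toDisk_disk t

theorem zetaBdry_infty : halfPlane.zetaBdry OnePoint.infty = 1 := rfl

theorem zetaBdry_coe (x : ℝ) :
    halfPlane.zetaBdry (OnePoint.some x) = ((x : ℂ) - I) / (x + I) := toDisk_halfPlane x

theorem add_I_ne_zero {z : ℂ} (hz : 0 ≤ z.im) : z + I ≠ 0 := by
  intro h
  have := congrArg Complex.im h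
  simp at this
  linarith

theorem ofReal_add_I_ne_zero (x : ℝ) : (x : ℂ) + I ≠ 0 := add_I_ne_zero (by simp)

theorem continuous_zetaBdry (O : Setting) : Continuous O.zetaBdry := by
  cases O with
  | disk =>
    have : disk.zetaBdry = fun t : Circle => (t : ℂ) := funext zetaBdry_disk
    rw [this]
    exact continuous_subtype_val
  | halfPlane =>
    refine (OnePoint.continuous_iff (X := ℝ) halfPlane.zetaBdry).2 ⟨?_, ?_⟩
    · have h1 : Tendsto (fun x : ℝ => ((x : ℂ) + I)) (cocompact ℝ) (Bornology.cobounded ℂ) := by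
        rw [← tendsto_norm_atTop_iff_cobounded]
        refine tendsto_atTop_mono (fun x => ?_) (tendsto_norm_cocompact_atTop (E := ℝ))
        simpa using Complex.abs_re_le_norm ((x : ℂ) + I)
      -- Continuity at `∞` from `(x - i)/(x + i) = 1 - 2i/(x + i)`.
      have h2 := ((tendsto_inv₀_cobounded.comp h1).const_mul (2 * I)).const_sub 1
      rw [coclosedCompact_eq_cocompact, zetaBdry_infty]
      rw [mul_zero, sub_zero] at h2
      refine h2.congr fun x => ?_
      have := ofReal_add_I_ne_zero x
      rw [zetaBdry_coe, Function.comp_apply]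
      field_simp
      ring
    · have : (fun x : ℝ => halfPlane.zetaBdry (OnePoint.some x)) =
          fun x : ℝ => ((x : ℂ) - I) / (x + I) := funext zetaBdry_coe
      rw [this]
      exact (by fun_prop : Continuous fun x : ℝ => (x : ℂ) - I).div (by fun_prop)
        ofReal_add_I_ne_zero

theorem norm_zetaBdry (O : Setting) (t : O.Boundary) : ‖O.zetaBdry t‖ = 1 := by
  cases O with
  | disk =>
    exact (congrArg norm (zetaBdry_disk t)).trans (Circle.norm_coe t)
  | halfPlane =>
    induction t using OnePoint.rec with
    | infty => rw [zetaBdry_infty, norm_one]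
    | coe x =>
      have h : (x : ℂ) - I = conj ((x : ℂ) + I) := by simp [sub_eq_add_neg]
      rw [zetaBdry_coe, norm_div, h, RCLike.norm_conj]
      exact div_self (norm_ne_zero_iff.2 (ofReal_add_I_ne_zero x))

theorem zetaBdry_injective (O : Setting) : Function.Injective O.zetaBdry := by
  cases O with
  | disk =>
    intro s t h
    exact Circle.ext ((zetaBdry_disk s).symm.trans (h.trans (zetaBdry_disk t)))
  | halfPlane =>
    have hne : ∀ x : ℝ, ((x : ℂ) - I) / (x + I) ≠ 1 := by
      intro x h
      rw [div_eq_one_iff_eq (ofReal_add_I_ne_zero x)] at h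
      have := congrArg Complex.im h
      norm_num at this
    intro s t h
    induction s using OnePoint.rec with
    | infty =>
      induction t using OnePoint.rec with
      | infty => rfl
      | coe y =>
        rw [zetaBdry_infty, zetaBdry_coe] at h
        exact absurd h.symm (hne y)
    | coe x =>
      induction t using OnePoint.rec with
      | infty =>
        rw [zetaBdry_infty, zetaBdry_coe] at h
        exact absurd h (hne x)
      | coe y =>
        rw [zetaBdry_coe, zetaBdry_coe,
          div_eq_div_iff (ofReal_add_I_ne_zero x) (ofReal_add_I_ne_zero y)] at h
        have h2 : (2 * I) * ((x : ℂ) - y) = 0 := by linear_combination h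
        have h3 : (x : ℂ) - y = 0 := by simpa using h2
        rw [Complex.ofReal_injective (sub_eq_zero.1 h3)]

/-- `ζ₀` on the boundary, as a continuous map. -/
noncomputable def coord (O : Setting) : C(O.Boundary, ℂ) := ⟨O.zetaBdry, O.continuous_zetaBdry⟩

theorem norm_coord (O : Setting) (t : O.Boundary) : ‖O.coord t‖ = 1 := O.norm_zetaBdry t

theorem isOpen_domain (O : Setting) : IsOpen O.domain := by
  cases O with
  | disk => exact isOpen_lt continuous_norm continuous_const
  | halfPlane => exact isOpen_lt continuous_const Complex.continuous_im

theorem continuousOn_toDisk (O : Setting) : ContinuousOn O.toDisk O.domain := by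
  cases O with
  | disk =>
    rw [show disk.toDisk = fun z => z from funext toDisk_disk]
    exact continuousOn_id
  | halfPlane =>
    rw [show halfPlane.toDisk = fun z => (z - I) / (z + I) from funext toDisk_halfPlane]
    exact (by fun_prop : ContinuousOn (fun z : ℂ => z - I) _).div (by fun_prop)
      fun z hz => add_I_ne_zero (le_of_lt hz)

theorem mapsTo_toDisk (O : Setting) : Set.MapsTo O.toDisk O.domain 𝔹 := by
  intro z hz
  rw [mem_ball_zero_iff]
  cases O with
  | disk => rwa [toDisk_disk]
  | halfPlane =>
    have hz' : 0 < z.im := hz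
    rw [toDisk_halfPlane, norm_div, div_lt_one (norm_pos_iff.2 (add_I_ne_zero hz'.le))]
    refine lt_of_pow_lt_pow_left₀ 2 (norm_nonneg _) ?_
    rw [← Complex.normSq_eq_norm_sq, ← Complex.normSq_eq_norm_sq, Complex.normSq_apply,
      Complex.normSq_apply]
    simp
    nlinarith

theorem surjOn_toDisk (O : Setting) : Set.SurjOn O.toDisk O.domain 𝔹 := by
  intro w hw
  rw [mem_ball_zero_iff] at hw
  cases O with
  | disk => exact ⟨w, hw, toDisk_disk w⟩
  | halfPlane =>
    have h1 : 1 - w ≠ 0 := by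
      intro h
      rw [← sub_eq_zero.1 h, norm_one] at hw
      exact lt_irrefl _ hw
    -- The preimage of `w` is given by the inverse Cayley transform `i(1 + w)/(1 - w)`.
    have h2 : I * (1 + w) / (1 - w) + I = 2 * I / (1 - w) := by
      field_simp
      ring
    have h3 : (I * (1 + w) / (1 - w)).im = (1 - ‖w‖ ^ 2) / normSq (1 - w) := by
      rw [← Complex.normSq_eq_norm_sq, Complex.div_im, Complex.normSq_apply w]
      simp
      ring
    refine ⟨I * (1 + w) / (1 - w), ?_, ?_⟩
    · change 0 < (I * (1 + w) / (1 - w)).im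
      rw [h3]
      exact div_pos (by nlinarith [norm_nonneg w]) (Complex.normSq_pos.2 h1)
    · rw [toDisk_halfPlane, h2]
      field_simp
      ring

/-- The unimodular constant relating `(z - α) / ϖ_α(z)` to a Blaschke factor in the disk. -/
noncomputable def rotation : Setting → ℂ → ℂ
  | disk, _ => 1
  | halfPlane, α => (I - conj α) / (α + I)

theorem varpi_ne_zero (O : Setting) {α z : ℂ} (hα : α ∈ O.domain) (hz : z ∈ O.domain) :
    O.varpi α z ≠ 0 := by
  cases O with
  | disk =>
    have := one_sub_mul_conj_ne (a := z) (w := α) (mem_ball_zero_iff.2 hz) (mem_ball_zero_iff.2 hα)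
    rwa [mul_comm] at this
  | halfPlane =>
    have h1 : 0 < α.im := hα
    have h2 : 0 < z.im := hz
    intro h
    have := congrArg Complex.im h
    simp [varpi] at this
    linarith

theorem I_sub_conj_ne_zero {α : ℂ} (hα : 0 < α.im) : I - conj α ≠ 0 := by
  intro h
  have := congrArg Complex.im h
  simp at this
  linarith

theorem continuousOn_rotation (O : Setting) : ContinuousOn O.rotation O.domain := by
  cases O with
  | disk => exact continuousOn_const
  | halfPlane =>
    exact (continuous_const.sub Complex.continuous_conj).continuousOn.div (by fun_prop)
      fun z hz => add_I_ne_zero (le_of_lt hz)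

/-- Both sides are Blaschke factors with zero `α`. Unlike `zconst`, which jumps at `α₀`, `rotation`
is continuous in `α`, so `zconst` is left as the only discontinuous factor. -/
theorem rotation_mul (O : Setting) {α z : ℂ} (hα : α ∈ O.domain) (hz : z ∈ O.domain) :
    O.rotation α * ((z - α) / O.varpi α z) =
      (O.toDisk z - O.toDisk α) / (1 - O.toDisk z * conj (O.toDisk α)) := by
  have hv := O.varpi_ne_zero hα hz
  have hb := one_sub_mul_conj_ne (O.mapsTo_toDisk hz) (O.mapsTo_toDisk hα)
  cases O with
  | disk => simp only [rotation, varpi, toDisk_disk, one_mul, mul_comm]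
  | halfPlane =>
    have h1 : α + I ≠ 0 := add_I_ne_zero (le_of_lt hα)
    have h2 : z + I ≠ 0 := add_I_ne_zero (le_of_lt hz)
    have h3 : I - conj α ≠ 0 := I_sub_conj_ne_zero hα
    have h4 : conj α + -I ≠ 0 := by
      intro h
      exact h3 (by linear_combination -h)
    simp only [toDisk_halfPlane, map_div₀, map_sub, map_add, Complex.conj_I] at hb ⊢
    change z - conj α ≠ 0 at hv
    change (I - conj α) / (α + I) * ((z - α) / (z - conj α)) = _
    rw [div_mul_div_comm, div_eq_div_iff (mul_ne_zero h1 hv) hb]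
    field_simp
    ring

theorem norm_zconst (O : Setting) {α : ℂ} (hα : α ∈ O.domain) : ‖O.zconst α‖ = 1 := by
  unfold zconst
  split_ifs with h
  · exact norm_one
  · cases O with
    | disk =>
      have h0 : ‖α‖ ≠ 0 := norm_ne_zero_iff.2 h
      simp [h0]
    | halfPlane =>
      have h0 : 1 + α ^ 2 ≠ 0 := by
        intro h0
        have h1 : (α - I) * (α + I) = 0 := by
          linear_combination h0 - Complex.I_sq
        rcases mul_eq_zero.1 h1 with h2 | h2
        · exact h (sub_eq_zero.1 h2)
        · exact add_I_ne_zero (le_of_lt hα) h2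
      have h1 : ‖1 + α ^ 2‖ ≠ 0 := norm_ne_zero_iff.2 h0
      simp only [norm_div, Complex.norm_real, norm_norm]
      exact div_self h1

theorem zconst_mul_conj (O : Setting) {α : ℂ} (hα : α ∈ O.domain) :
    O.zconst α * conj (O.zconst α) = 1 := by
  rw [Complex.mul_conj, Complex.normSq_eq_norm_sq, O.norm_zconst hα]
  norm_num

theorem continuousOn_moebius (O : Setting) :
    ContinuousOn (fun p : ℂ × ℂ => (p.2 - p.1) / O.varpi p.1 p.2) (O.domain ×ˢ O.domain) := by
  have hc : Continuous fun p : ℂ × ℂ => conj p.1 := Complex.continuous_conj.comp continuous_fst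
  refine ContinuousOn.div (by fun_prop) ?_ fun p hp => O.varpi_ne_zero hp.1 hp.2
  cases O with
  | disk => exact (continuous_const.sub (hc.mul continuous_snd)).continuousOn
  | halfPlane => exact (continuous_snd.sub hc).continuousOn

/-! ### The Carathéodory functions -/

theorem DR_eq (O : Setting) {α : ℂ} (hα : α ∈ O.domain) (t : O.Boundary) :
    O.DR t α = (1 - ‖O.toDisk α‖ ^ 2) / ‖O.coord t - O.toDisk α‖ ^ 2 := by
  have ha := O.mapsTo_toDisk hα
  have h1 := coord_ne O.norm_coord ha t
  have h2 := coord_ne_zero O.norm_coord t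
  have h3 : 1 - O.coord t * conj (O.toDisk α) ≠ 0 := by
    rw [mul_comm]
    exact one_sub_conj_mul_coord_ne O.norm_coord ha t
  have key : ((2 * O.DR t α : ℝ) : ℂ) =
      ((2 * ((1 - ‖O.toDisk α‖ ^ 2) / ‖O.coord t - O.toDisk α‖ ^ 2) : ℝ) : ℂ) := by
    unfold DR
    rw [← Complex.add_conj]
    change (O.coord t + O.toDisk α) / (O.coord t - O.toDisk α) +
      conj ((O.coord t + O.toDisk α) / (O.coord t - O.toDisk α)) = _
    push_cast
    simp only [← Complex.mul_conj', map_add, map_div₀, map_sub, conj_coord O.norm_coord]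
    have h5 : (O.coord t)⁻¹ - conj (O.toDisk α) ≠ 0 := by
      rw [← conj_coord O.norm_coord, ← map_sub]
      exact (map_ne_zero _).2 h1
    field_simp
    ring
  have := Complex.ofReal_injective key
  linarith

theorem DR_pos (O : Setting) {α : ℂ} (hα : α ∈ O.domain) (t : O.Boundary) : 0 < O.DR t α := by
  have ha := O.mapsTo_toDisk hα
  have h1 := norm_pos_iff.2 (coord_ne O.norm_coord ha t)
  rw [O.DR_eq hα]
  rw [mem_ball_zero_iff] at ha
  exact div_pos (by nlinarith [norm_nonneg (O.toDisk α)]) (by positivity)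

theorem inv_DR_eq (O : Setting) {α : ℂ} (hα : α ∈ O.domain) (t : O.Boundary) :
    ((1 / O.DR t α : ℝ) : ℂ) = poissonInv O.coord (O.toDisk α) t := by
  rw [poissonInv_apply, O.DR_eq hα, one_div_div, Complex.mul_conj', Complex.mul_conj']
  push_cast
  rfl

/-- The kernel `D(t,z) / D_R(t,α)`. -/
noncomputable def weightedKernel (O : Setting) (α z : ℂ) : C(O.Boundary, ℂ) :=
  poissonInv O.coord (O.toDisk α) *
    (1 + (2 * O.toDisk z) • cauchyKernel O.coord (O.toDisk z))

theorem D_eq (O : Setting) (z : ℂ) (t : O.Boundary) :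
    O.D t z = (O.coord t + O.toDisk z) / (O.coord t - O.toDisk z) := rfl

theorem weightedKernel_apply (O : Setting) {α z : ℂ} (hα : α ∈ O.domain) (hz : z ∈ O.domain)
    (t : O.Boundary) : O.weightedKernel α z t = ((1 / O.DR t α : ℝ) : ℂ) * O.D t z := by
  have h1 := coord_ne O.norm_coord (O.mapsTo_toDisk hz) t
  rw [inv_DR_eq O hα, D_eq]
  simp only [weightedKernel, ContinuousMap.mul_apply, ContinuousMap.add_apply,
    ContinuousMap.one_apply, ContinuousMap.smul_apply, smul_eq_mul,
    cauchyKernel_apply O.norm_coord (O.mapsTo_toDisk hz)]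
  field_simp
  ring

/-- The right side is `(D(t,z) - i D_I(t,α)) / D_R(t,α)`, the integrand of `F_α`, which equals `1`
at `z = α`. -/
theorem caraKernel_eq (O : Setting) {α z : ℂ} (hα : α ∈ O.domain) (hz : z ∈ O.domain)
    (t : O.Boundary) : caraKernel O.coord (O.toDisk α, O.toDisk z) t =
      O.weightedKernel α z t - I * ((O.DI t α / O.DR t α : ℝ) : ℂ) := by
  have ha := O.mapsTo_toDisk hα
  have hw := O.mapsTo_toDisk hz
  have h1 := coord_ne O.norm_coord hw t
  have h2 := coord_ne_zero O.norm_coord t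
  have h4 := coord_ne O.norm_coord ha t
  have h3 := one_sub_mul_conj_ne ha ha
  have h6 := one_sub_conj_mul_coord_ne O.norm_coord ha t
  have hI : I * ((O.DI t α : ℝ) : ℂ) = (O.D t α - conj (O.D t α)) / 2 := by
    rw [Complex.sub_conj]
    unfold DI
    push_cast
    ring
  have h5 : (O.coord t)⁻¹ - conj (O.toDisk α) ≠ 0 := by
    rw [← conj_coord O.norm_coord, ← map_sub]
    exact (map_ne_zero _).2 h4
  rw [O.weightedKernel_apply hα hz, div_eq_mul_one_div (O.DI t α), Complex.ofReal_mul, ← mul_assoc, hI,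
    inv_DR_eq O hα, poissonInv_apply, caraKernel_apply O.norm_coord _ hw, D_eq, D_eq]
  simp only [map_add, map_div₀, map_sub, conj_coord O.norm_coord]
  field_simp
  ring

theorem Fα_eq (O : Setting) {α z : ℂ} (hα : α ∈ O.domain) (hz : z ∈ O.domain)
    (μ : Measure O.Boundary) [IsFiniteMeasure μ] :
    O.Fα α μ z = integralFunctional μ (caraKernel O.coord (O.toDisk α, O.toDisk z)) := by
  have hre : (fun t => 1 / O.DR t α) = fun t => (poissonInv O.coord (O.toDisk α) t).re := by
    funext t
    rw [← inv_DR_eq O hα, Complex.ofReal_re]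
  have hmeas : Measurable fun t => ENNReal.ofReal (1 / O.DR t α) := by
    have h := (Complex.continuous_re.comp
      (poissonInv O.coord (O.toDisk α)).continuous).measurable.ennreal_ofReal
    rwa [show (fun t => ENNReal.ofReal (1 / O.DR t α)) = fun t =>
      ENNReal.ofReal (poissonInv O.coord (O.toDisk α) t).re from
      funext fun t => congrArg ENNReal.ofReal (congrFun hre t)]
  have him : (fun t => O.DI t α / O.DR t α) = fun t => (O.weightedKernel α α t).im := by
    funext t
    rw [O.weightedKernel_apply hα hα, Complex.im_ofReal_mul]
    unfold DI
    ring
  have hint : Integrable (fun t => ((O.DI t α / O.DR t α : ℝ) : ℂ)) μ := by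
    have h := (integrable_continuousMap μ (O.weightedKernel α α)).im
    exact Integrable.ofReal (h.congr (ae_of_all _ fun t => (congrFun him t).symm))
  have h1 : O.F (μ.withDensity fun t => ENNReal.ofReal (1 / O.DR t α)) z =
      ∫ t, O.weightedKernel α z t ∂μ := by
    unfold F
    rw [integral_withDensity_eq_integral_toReal_smul hmeas (by simp)]
    refine integral_congr_ae (ae_of_all _ fun t => ?_)
    change (ENNReal.ofReal (1 / O.DR t α)).toReal • O.D t z = _
    rw [ENNReal.toReal_ofReal (one_div_pos.2 (O.DR_pos hα t)).le, O.weightedKernel_apply hα hz,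
      Complex.real_smul]
  unfold Fα c
  rw [h1, Complex.ofReal_neg, mul_neg, ← sub_eq_add_neg, ← integral_complex_ofReal,
    ← integral_const_mul, ← integral_sub (integrable_continuousMap μ _) (hint.const_mul I)]
  exact integral_congr_ae (ae_of_all _ fun t => (O.caraKernel_eq hα hz t).symm)

theorem Fα_re_nonneg (O : Setting) {α z : ℂ} (hα : α ∈ O.domain) (hz : z ∈ O.domain)
    (μ : Measure O.Boundary) [IsFiniteMeasure μ] : 0 ≤ (O.Fα α μ z).re := by
  rw [O.Fα_eq hα hz]
  have := integral_re (𝕜 := ℂ) (integrable_continuousMap μ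
    (caraKernel O.coord (O.toDisk α, O.toDisk z)))
  refine le_of_le_of_eq ?_ this
  exact integral_nonneg fun t =>
    caraKernel_re_nonneg O.norm_coord (O.mapsTo_toDisk hα) (O.mapsTo_toDisk hz) t

theorem one_le_norm_Fα_add_one (O : Setting) {α z : ℂ} (hα : α ∈ O.domain) (hz : z ∈ O.domain)
    (μ : Measure O.Boundary) [IsFiniteMeasure μ] : 1 ≤ ‖O.Fα α μ z + 1‖ := by
  refine le_trans ?_ (Complex.re_le_norm _)
  have := O.Fα_re_nonneg hα hz μ
  simpa using this

/-! ### The Schur functions -/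

/-- The continuous factor in the integral representation of the Schur function. -/
noncomputable def schurCoeff (O : Setting) (p : ℂ × ℂ) : ℂ :=
  O.rotation p.1 * (2 * (1 - O.toDisk p.2 * conj (O.toDisk p.1)) /
    (1 - O.toDisk p.1 * conj (O.toDisk p.1)))

theorem continuousOn_toDisk_prod (O : Setting) :
    ContinuousOn (fun p : ℂ × ℂ => (O.toDisk p.1, O.toDisk p.2)) (O.domain ×ˢ O.domain) :=
  (O.continuousOn_toDisk.comp continuousOn_fst fun _ hp => hp.1).prodMk
    (O.continuousOn_toDisk.comp continuousOn_snd fun _ hp => hp.2)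

theorem mapsTo_toDisk_prod (O : Setting) :
    Set.MapsTo (fun p : ℂ × ℂ => (O.toDisk p.1, O.toDisk p.2)) (O.domain ×ˢ O.domain)
      (𝔹 ×ˢ 𝔹) :=
  fun _ hp => ⟨O.mapsTo_toDisk hp.1, O.mapsTo_toDisk hp.2⟩

theorem continuousOn_schurCoeff (O : Setting) :
    ContinuousOn O.schurCoeff (O.domain ×ˢ O.domain) := by
  have h1 : ContinuousOn (fun p : ℂ × ℂ => O.toDisk p.1) (O.domain ×ˢ O.domain) :=
    O.continuousOn_toDisk.comp continuousOn_fst fun _ hp => hp.1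
  have h2 : ContinuousOn (fun p : ℂ × ℂ => O.toDisk p.2) (O.domain ×ˢ O.domain) :=
    O.continuousOn_toDisk.comp continuousOn_snd fun _ hp => hp.2
  have h3 := Complex.continuous_conj.comp_continuousOn h1
  refine (O.continuousOn_rotation.comp continuousOn_fst fun _ hp => hp.1).mul
    (ContinuousOn.div (continuousOn_const.mul (continuousOn_const.sub (h2.mul h3)))
      (continuousOn_const.sub (h1.mul h3)) fun p hp => ?_)
  exact one_sub_mul_conj_ne (O.mapsTo_toDisk hp.1) (O.mapsTo_toDisk hp.1)

/-- The factor `w - a` in `caraKernel - 1` carries the zero of `ζ_α`; the conjugate of `zconst`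
undoes the unimodular constant in `ζ_α`. -/
theorem zeta_mul_schur_formula (O : Setting) {α z : ℂ} (hα : α ∈ O.domain) (hz : z ∈ O.domain)
    (μ : Measure O.Boundary) [IsProbabilityMeasure μ] :
    O.zeta α z * (conj (O.zconst α) * O.schurCoeff (α, z) *
      integralFunctional μ (schurKernel O.coord (O.toDisk α, O.toDisk z))) =
      O.Fα α μ z - 1 := by
  have hrot := O.rotation_mul hα hz
  have hb := one_sub_mul_conj_ne (O.mapsTo_toDisk hz) (O.mapsTo_toDisk hα)
  have ha := one_sub_mul_conj_ne (O.mapsTo_toDisk hα) (O.mapsTo_toDisk hα)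
  have hz1 := O.zconst_mul_conj hα
  rw [O.Fα_eq hα hz, caraKernel, map_add, map_smul, integralFunctional_one, smul_eq_mul,
    add_sub_cancel_left]
  set A := integralFunctional μ (schurKernel O.coord (O.toDisk α, O.toDisk z))
  calc _ = (O.zconst α * conj (O.zconst α)) * (O.rotation α * ((z - α) / O.varpi α z)) *
        (2 * (1 - O.toDisk z * conj (O.toDisk α)) /
          (1 - O.toDisk α * conj (O.toDisk α))) * A := by
        simp only [zeta, schurCoeff]; ring
    _ = _ := by
        rw [hz1, hrot]
        field_simp

/-- Away from `α` divide by `ζ_α`. The right side is continuous on the whole domain, so at `z = α`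
it is the limit that defines `fα`. -/
theorem fα_eq (O : Setting) {α z : ℂ} (hα : α ∈ O.domain) (hz : z ∈ O.domain)
    (μ : Measure O.Boundary) [IsProbabilityMeasure μ] :
    O.fα α μ z = conj (O.zconst α) * O.schurCoeff (α, z) *
      integralFunctional μ (schurKernel O.coord (O.toDisk α, O.toDisk z)) *
      (O.Fα α μ z + 1)⁻¹ := by
  have hF : ∀ z ∈ O.domain, O.Fα α μ z + 1 ≠ 0 := fun z hz =>
    norm_pos_iff.1 (one_pos.trans_le (O.one_le_norm_Fα_add_one hα hz μ))
  have hoff : ∀ z ∈ O.domain, z ≠ α →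
      1 / O.zeta α z * ((O.Fα α μ z - 1) / (O.Fα α μ z + 1)) =
      conj (O.zconst α) * O.schurCoeff (α, z) *
        integralFunctional μ (schurKernel O.coord (O.toDisk α, O.toDisk z)) *
        (O.Fα α μ z + 1)⁻¹ := by
    intro z hz hne
    have hζ : O.zeta α z ≠ 0 := mul_ne_zero
      (norm_ne_zero_iff.1 (by rw [O.norm_zconst hα]; exact one_ne_zero))
      (div_ne_zero (sub_ne_zero.2 hne) (O.varpi_ne_zero hα hz))
    rw [← O.zeta_mul_schur_formula hα hz μ]
    field_simp
  unfold fα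
  by_cases hzα : z = α
  · subst hzα
    rw [Function.update_self]
    refine Tendsto.limUnder_eq ?_
    have hpair : ContinuousOn (fun x : ℂ => (z, x)) O.domain := by fun_prop
    have hpairm : Set.MapsTo (fun x : ℂ => (z, x)) O.domain (O.domain ×ˢ O.domain) :=
      fun x hx => ⟨hz, hx⟩
    have hd := O.continuousOn_toDisk_prod.comp hpair hpairm
    have hdm := O.mapsTo_toDisk_prod.comp hpairm
    have hc1 : ContinuousOn (fun x => integralFunctional μ
        (schurKernel O.coord (O.toDisk z, O.toDisk x))) O.domain :=
      (continuous_integralFunctional μ).comp_continuousOn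
        ((continuousOn_schurKernel O.norm_coord).comp hd hdm)
    have hc2 : ContinuousOn (O.Fα z μ) O.domain :=
      ((continuous_integralFunctional μ).comp_continuousOn
        ((continuousOn_caraKernel O.norm_coord).comp hd hdm)).congr
          fun x hx => O.Fα_eq hz hx μ
    have hc : ContinuousOn (fun x => conj (O.zconst z) * O.schurCoeff (z, x) *
        integralFunctional μ (schurKernel O.coord (O.toDisk z, O.toDisk x)) *
        (O.Fα z μ x + 1)⁻¹) O.domain :=
      ((continuousOn_const.mul (O.continuousOn_schurCoeff.comp hpair hpairm)).mul hc1).mul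
        ((hc2.add continuousOn_const).inv₀ hF)
    have hnhds := O.isOpen_domain.mem_nhds hz
    refine ((hc.continuousAt hnhds).tendsto.mono_left nhdsWithin_le_nhds).congr' ?_
    filter_upwards [self_mem_nhdsWithin, mem_nhdsWithin_of_mem_nhds hnhds] with x hx hxO
    exact (hoff x hxO hx).symm
  · rw [Function.update_of_ne hzα]
    exact hoff z hz hzα

theorem zeta_mul_fα (O : Setting) {α z : ℂ} (hα : α ∈ O.domain) (hz : z ∈ O.domain)
    (μ : Measure O.Boundary) [IsProbabilityMeasure μ] :
    O.zeta α z * O.fα α μ z = (O.Fα α μ z - 1) * (O.Fα α μ z + 1)⁻¹ := by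
  rw [O.fα_eq hα hz, ← O.zeta_mul_schur_formula hα hz μ]
  ring

/-! ### The equivalences -/

section Equivalences

variable {O : Setting} {α β : ℕ → ℂ} {μ ν : ℕ → Measure O.Boundary}
  [∀ k, IsProbabilityMeasure (μ k)] [∀ k, IsProbabilityMeasure (ν k)]

theorem precompactIn_toDisk_prod {x z : ℕ → ℂ} (hx : PrecompactIn O.domain x)
    (hz : PrecompactIn O.domain z) :
    PrecompactIn (𝔹 ×ˢ 𝔹) (fun k => (O.toDisk (x k), O.toDisk (z k))) :=
  (hx.prodMk hz).image O.continuousOn_toDisk_prod O.mapsTo_toDisk_prod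

theorem tendsto_prodMk_sub (hαβ : Tendsto (fun k => α k - β k) atTop (𝓝 0)) (z : ℕ → ℂ) :
    Tendsto (fun k => (α k, z k) - (β k, z k)) atTop (𝓝 0) := by
  have : Tendsto (fun k => (α k - β k, (0 : ℂ))) atTop (𝓝 (0, 0)) :=
    hαβ.prodMk_nhds tendsto_const_nhds
  simpa [Prod.zero_eq_mk] using this

theorem bddClose_toDisk_prod (hα : PrecompactIn O.domain α) (hβ : PrecompactIn O.domain β)
    (hαβ : Tendsto (fun k => α k - β k) atTop (𝓝 0)) {z : ℕ → ℂ} (hz : PrecompactIn O.domain z) :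
    BddClose (fun k => (O.toDisk (α k), O.toDisk (z k)))
      (fun k => (O.toDisk (β k), O.toDisk (z k))) :=
  (hα.prodMk hz).bddClose (hβ.prodMk hz) (tendsto_prodMk_sub hαβ z) O.continuousOn_toDisk_prod

/-- Integrals of a jointly continuous family of kernels are asymptotically equal. -/
theorem bddClose_integral (hα : PrecompactIn O.domain α) (hβ : PrecompactIn O.domain β)
    (hαβ : Tendsto (fun k => α k - β k) atTop (𝓝 0)) (h : O.DiffWeakStarToZero μ ν)
    {Φ : ℂ × ℂ → C(O.Boundary, ℂ)} (hΦ : ContinuousOn Φ (𝔹 ×ˢ 𝔹))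
    {z : ℕ → ℂ} (hz : PrecompactIn O.domain z) :
    BddClose (fun k => integralFunctional (μ k) (Φ (O.toDisk (α k), O.toDisk (z k))))
      (fun k => integralFunctional (ν k) (Φ (O.toDisk (β k), O.toDisk (z k)))) := by
  have h1 := precompactIn_toDisk_prod hα hz
  have h2 := precompactIn_toDisk_prod hβ hz
  have h3 := h1.image hΦ (Set.mapsTo_univ _ _)
  have h4 := h2.image hΦ (Set.mapsTo_univ _ _)
  exact ⟨h3.integral_bdd μ, h4.integral_bdd ν, tendsto_integral_sub_of_close h3
    (h1.bddClose h2 (bddClose_toDisk_prod hα hβ hαβ hz).tendsto hΦ).tendsto h⟩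

theorem Fα_bddClose (hα : PrecompactIn O.domain α) (hβ : PrecompactIn O.domain β)
    (hαβ : Tendsto (fun k => α k - β k) atTop (𝓝 0)) (h : O.DiffWeakStarToZero μ ν)
    {z : ℕ → ℂ} (hz : PrecompactIn O.domain z) :
    BddClose (fun k => O.Fα (α k) (μ k) (z k)) (fun k => O.Fα (β k) (ν k) (z k)) := by
  have := bddClose_integral hα hβ hαβ h (continuousOn_caraKernel O.norm_coord) hz
  simp only [O.Fα_eq (hα.mem _) (hz.mem _), O.Fα_eq (hβ.mem _) (hz.mem _)]
  exact this

theorem cara_tendsto_iff_weakStar (hα : PrecompactIn O.domain α) (hβ : PrecompactIn O.domain β)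
    (hαβ : Tendsto (fun k => α k - β k) atTop (𝓝 0)) :
    O.TendsToZeroOnCompacts (fun k z => O.Fα (α k) (μ k) z - O.Fα (β k) (ν k) z) ↔
      O.DiffWeakStarToZero μ ν := by
  rw [tendsToZeroOnCompacts_iff]
  constructor
  · intro H
    refine tendsto_integral_sub_of_cara O.norm_coord O.zetaBdry_injective
      (hα.image O.continuousOn_toDisk O.mapsTo_toDisk)
      (hβ.image O.continuousOn_toDisk O.mapsTo_toDisk)
      (hα.bddClose hβ hαβ O.continuousOn_toDisk).tendsto fun w hw => ?_
    -- Pointwise convergence is enough here, so constant sequences are used.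
    obtain ⟨z, hz, rfl⟩ := O.surjOn_toDisk hw
    refine (H (fun _ => z) ⟨{z}, isCompact_singleton, Set.singleton_subset_iff.2 hz,
      fun _ => rfl⟩).congr fun k => ?_
    rw [O.Fα_eq (hα.mem k) hz, O.Fα_eq (hβ.mem k) hz]
  · exact fun h z hz => (Fα_bddClose hα hβ hαβ h hz).tendsto

theorem zconst_bddClose (hα : PrecompactIn O.domain α) (hβ : PrecompactIn O.domain β)
    (hz : Tendsto (fun k => O.zconst (α k) - O.zconst (β k)) atTop (𝓝 0)) :
    BddClose (fun k => O.zconst (α k)) (fun k => O.zconst (β k)) :=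
  ⟨⟨1, fun k => (O.norm_zconst (hα.mem k)).le⟩, ⟨1, fun k => (O.norm_zconst (hβ.mem k)).le⟩, hz⟩

theorem schur_tendsto_of_weakStar (hα : PrecompactIn O.domain α) (hβ : PrecompactIn O.domain β)
    (hαβ : Tendsto (fun k => α k - β k) atTop (𝓝 0))
    (hζ : Tendsto (fun k => O.zconst (α k) - O.zconst (β k)) atTop (𝓝 0))
    (h : O.DiffWeakStarToZero μ ν) :
    O.TendsToZeroOnCompacts (fun k z => O.fα (α k) (μ k) z - O.fα (β k) (ν k) z) := by
  rw [tendsToZeroOnCompacts_iff]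
  intro z hz
  -- The only factor that needs the hypothesis on `zconst`; the others are continuous in `α`.
  have h1 := (zconst_bddClose hα hβ hζ).star
  have h2 := (hα.prodMk hz).bddClose (hβ.prodMk hz) (tendsto_prodMk_sub hαβ z)
    O.continuousOn_schurCoeff
  have h3 := bddClose_integral hα hβ hαβ h (continuousOn_schurKernel O.norm_coord) hz
  have h4 : BddClose (fun k => (O.Fα (α k) (μ k) (z k) + 1)⁻¹)
      (fun k => (O.Fα (β k) (ν k) (z k) + 1)⁻¹) := by
    refine BddClose.inv ?_ (fun k => O.one_le_norm_Fα_add_one (hα.mem k) (hz.mem k) _)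
      (fun k => O.one_le_norm_Fα_add_one (hβ.mem k) (hz.mem k) _)
    simpa using (Fα_bddClose hα hβ hαβ h hz).tendsto
  have := (((h1.mul h2).mul h3).mul h4).tendsto
  simp only [O.fα_eq (hα.mem _) (hz.mem _), O.fα_eq (hβ.mem _) (hz.mem _)]
  exact this

theorem Fα_add_one_bdd (hα : PrecompactIn O.domain α) {z : ℕ → ℂ} (hz : PrecompactIn O.domain z) :
    ∃ C, ∀ k, ‖O.Fα (α k) (μ k) (z k) + 1‖ ≤ C := by
  obtain ⟨C, hC⟩ := ((precompactIn_toDisk_prod hα hz).image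
    (continuousOn_caraKernel O.norm_coord) (Set.mapsTo_univ _ _)).integral_bdd μ
  refine ⟨C + 1, fun k => ?_⟩
  rw [O.Fα_eq (hα.mem k) (hz.mem k)]
  exact (norm_add_le _ _).trans (by rw [norm_one]; linarith [hC k])

theorem fα_bdd (hα : PrecompactIn O.domain α) {z : ℕ → ℂ} (hz : PrecompactIn O.domain z) :
    ∃ C, ∀ k, ‖O.fα (α k) (μ k) (z k)‖ ≤ C := by
  simp only [O.fα_eq (hα.mem _) (hz.mem _)]
  refine exists_norm_mul_le (exists_norm_mul_le (exists_norm_mul_le ?_ ?_) ?_) ?_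
  · exact ⟨1, fun k => by rw [RCLike.norm_conj, O.norm_zconst (hα.mem k)]⟩
  · exact (hα.prodMk hz).bdd_comp O.continuousOn_schurCoeff
  · exact ((precompactIn_toDisk_prod hα hz).image
      (continuousOn_schurKernel O.norm_coord) (Set.mapsTo_univ _ _)).integral_bdd μ
  · refine ⟨1, fun k => ?_⟩
    rw [norm_inv]
    exact inv_le_one_of_one_le₀ (O.one_le_norm_Fα_add_one (hα.mem k) (hz.mem k) _)

/-- For `s = (F - 1)/(F + 1)` and likewise `s'`, one has `F - F' = (s - s')(F + 1)(F' + 1)/2`. Here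
`s = ζ_α f_α`, and `F`, `F'` are bounded along the sequence. -/
theorem cara_tendsto_of_schur (hα : PrecompactIn O.domain α) (hβ : PrecompactIn O.domain β)
    (hαβ : Tendsto (fun k => α k - β k) atTop (𝓝 0))
    (hζ : Tendsto (fun k => O.zconst (α k) - O.zconst (β k)) atTop (𝓝 0))
    (h : O.TendsToZeroOnCompacts (fun k z => O.fα (α k) (μ k) z - O.fα (β k) (ν k) z)) :
    O.TendsToZeroOnCompacts (fun k z => O.Fα (α k) (μ k) z - O.Fα (β k) (ν k) z) := by
  rw [tendsToZeroOnCompacts_iff] at h ⊢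
  intro z hz
  have h1 := (zconst_bddClose hα hβ hζ).mul ((hα.prodMk hz).bddClose (hβ.prodMk hz)
    (tendsto_prodMk_sub hαβ z) O.continuousOn_moebius)
  have h2 : BddClose (fun k => O.fα (α k) (μ k) (z k)) (fun k => O.fα (β k) (ν k) (z k)) :=
    ⟨fα_bdd hα hz, fα_bdd hβ hz, h z hz⟩
  have h3 := tendsto_zero_mul_bdd (h1.mul h2).tendsto
    (exists_norm_mul_le (Fα_add_one_bdd (μ := μ) hα hz) (Fα_add_one_bdd (μ := ν) hβ hz))
  have h4 := h3.const_mul (1 / 2)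
  rw [mul_zero] at h4
  refine h4.congr fun k => ?_
  have e1 := O.zeta_mul_fα (hα.mem k) (hz.mem k) (μ k)
  have e2 := O.zeta_mul_fα (hβ.mem k) (hz.mem k) (ν k)
  have n1 : O.Fα (α k) (μ k) (z k) + 1 ≠ 0 :=
    norm_pos_iff.1 (one_pos.trans_le (O.one_le_norm_Fα_add_one (hα.mem k) (hz.mem k) (μ k)))
  have n2 : O.Fα (β k) (ν k) (z k) + 1 ≠ 0 :=
    norm_pos_iff.1 (one_pos.trans_le (O.one_le_norm_Fα_add_one (hβ.mem k) (hz.mem k) (ν k)))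
  change 1 / 2 * ((O.zeta (α k) (z k) * O.fα (α k) (μ k) (z k) -
    O.zeta (β k) (z k) * O.fα (β k) (ν k) (z k)) * _) = _
  rw [e1, e2]
  field_simp
  ring

end Equivalences

end Setting

end SchurCara

theorem mainTheorem9 (O : SchurCara.Setting) (α β : ℕ → ℂ)
    (hα : O.CompactlyIncluded α) (hβ : O.CompactlyIncluded β)
    (hαβ : Tendsto (fun k => α k - β k) atTop (𝓝 0))
    (μ ν : ℕ → Measure O.Boundary)
    (hμ : ∀ k, IsProbabilityMeasure (μ k)) (hν : ∀ k, IsProbabilityMeasure (ν k)) :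
    (O.TendsToZeroOnCompacts (fun k z => O.Fα (α k) (μ k) z - O.Fα (β k) (ν k) z) ↔
      O.DiffWeakStarToZero μ ν) ∧
    (Tendsto (fun k => O.zconst (α k) - O.zconst (β k)) atTop (𝓝 0) →
      (O.TendsToZeroOnCompacts (fun k z => O.Fα (α k) (μ k) z - O.Fα (β k) (ν k) z) ↔
        O.TendsToZeroOnCompacts (fun k z => O.fα (α k) (μ k) z - O.fα (β k) (ν k) z)) ∧
      (O.TendsToZeroOnCompacts (fun k z => O.fα (α k) (μ k) z - O.fα (β k) (ν k) z) ↔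
        O.DiffWeakStarToZero μ ν)) := by
  -- `CompactlyIncluded` is definitionally `PrecompactIn O.domain`, so `hα` and `hβ` apply as they
  -- are.
  have h13 := SchurCara.Setting.cara_tendsto_iff_weakStar (μ := μ) (ν := ν) hα hβ hαβ
  refine ⟨h13, fun hζ => ?_⟩
  have h21 := SchurCara.Setting.cara_tendsto_of_schur (μ := μ) (ν := ν) hα hβ hαβ hζ
  have h32 := SchurCara.Setting.schur_tendsto_of_weakStar (μ := μ) (ν := ν) hα hβ hαβ hζ
  exact ⟨⟨fun h => h32 (h13.1 h), h21⟩, ⟨fun h => h13.1 (h21 h), h32⟩⟩
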